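/- **Definitions.** A two-colored partition $p$ consists of two finite totally ordered rows of points (the upper and the lower row), a coloring of all points with the colors $\circ$ and $\bullet$, and a decomposition of the set of all points into blocks; it is considered up to color-preserving isomorphism. It is a pair partition if every block has exactly two points. Let $\mathcal P^{\circ\bullet}$ be the set of all two-colored partitions. The tensor product $p\otimes p'$ appends each row of $p'$ at the right end of the respective row of $p$; the involution $p^*$ exchanges the two rows; if the lower row of $p'$ and the upper row of $p$ agree in size and coloration, the composition $pp'$ has the upper row of $p'$ and the lower row of $p$, and is obtained by gluing $p'$ on top of $p$ along the common row, joining blocks that meet there, and deleting the common row. A category is a subset of $\mathcal P^{\circ\bullet}$ that is closed under tensor products, involutions and compositions and contains the two one-block partitions with one upper and one lower point, both of the same color ($\circ$ or $\bullet$), and the two one-block partitions with no upper point and two lower points, colored $\bullet\circ$ and $\circ\bullet$. For $\mathcal G\subseteq\mathcal P^{\circ\bullet}$ let $\langle\mathcal G\rangle$ be the smallest category that contains $\mathcal G$. The points of $p$ are ordered cyclically: the lower row from left to right, then the upper row from right to left. Intervals $]\alpha,\beta[_p$, $]\alpha,\beta]_p$, $[\alpha,\beta]_p$ refer to this cyclic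 order, with $]\alpha,\alpha]_p=\emptyset$ and $[\alpha,\alpha]_p=\{\alpha\}$. The normalized color of a lower point is its color, that of an upper point is the inverse of its color. For a set $S$ of points, $\sigma_p(S)$ is the number of points of $S$ of normalized color $\circ$ minus the number of those of normalized color $\bullet$. A sector is a proper subset of the set of points of the form $[\alpha,\beta]_p$ such that $\{\alpha,\beta\}$ is a block. Two blocks $B,B'$ cross if there are pairwise distinct $\alpha,\beta\in B$, $\gamma,\delta\in B'$ that occur in the cyclic order $(\alpha,\gamma,\beta,\delta)$. Let $\mathcal S_0$ be the set of all pair partitions $p$ with $\sigma_p(B)=0$ for all blocks $B$ and $\sigma_p(S)=0$ for all sectors $S$ of $p$. For $p\in\mathcal S_0$ and blocks $B\ni\alpha$, $B'\ni\alpha'$ of $p$, the color distance $d_p(B,B')$ is $|\sigma_p(]\alpha,\alpha'[_p)|$ if $\alpha,\alpha'$ have different normalized colors and $|\sigma_p(]\alpha,\alpha']_p)|$ if they have the same normalized color; it does not depend on the choice of $\alpha\in B$ and $\alpha'\in B'$. For a subsemigroup $D$ of $(\mathbb N_0,+)$ (possibly empty), let $\mathcal I_D$ be the set of all $p\in\mathcal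 S_0$ such that any two blocks $B,B'$ of $p$ with $d_p(B,B')\in D$ do not cross. **Corollary.** Let $D$ be a subsemigroup of $(\mathbb N_0,+)$ such that $\mathbb N\setminus D$ is infinite, where $\mathbb N=\{1,2,\dots\}$. Then $\mathcal I_D$ is a category, and every set $\mathcal G\subseteq\mathcal P^{\circ\bullet}$ with $\langle\mathcal G\rangle=\mathcal I_D$ is infinite. In particular, there is a category of two-colored partitions that is not generated by any finite set of partitions. -/

import Mathlib

namespace TwoColored

/-- The two colors of points. -/
inductive Color : Type
  | white : Color
  | black : Color
  deriving DecidableEq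

/-- The inverse color. -/
def Color.inv : Color → Color
  | .white => .black
  | .black => .white

/-- The density of the color sum: `1` for white, `-1` for black. -/
def Color.sign : Color → ℤ
  | .white => 1
  | .black => -1

/-- The points of a partition whose upper row is colored by `u` and whose lower row is colored
by `l` (both rows read from left to right): the disjoint union of the two rows. -/
abbrev Points (u l : List Color) : Type := Fin u.length ⊕ Fin l.length

/-- A two-colored partition. A finite totally ordered set with a coloring is recorded as the list
of its colors from left to right; the decomposition of the points into blocks is recorded as an
equivalence relation, whose classes are the blocks. -/
structure ColPartition : Type where
  /-- colors of the upper row, from left to right -/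
  upper : List Color
  /-- colors of the lower row, from left to right -/
  lower : List Color
  /-- the decomposition of the points into blocks -/
  rel : Setoid (Points upper lower)

/-! ### Category operations -/

/-- The decomposition of the points of `p ⊗ p'` into those of `p` (on the left) and those of `p'`
(on the right), in both rows. -/
def tensorSplit (u u' l l' : List Color) :
    Points (u ++ u') (l ++ l') → Points u l ⊕ Points u' l' :=
  Sum.elim
    (fun i => Sum.map Sum.inl Sum.inl (finSumFinEquiv.symm (Fin.cast List.length_append i)))
    (fun j => Sum.map Sum.inr Sum.inr (finSumFinEquiv.symm (Fin.cast List.length_append j)))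

/-- The disjoint union of two equivalence relations. -/
def sumSetoid {X Y : Type} (r : Setoid X) (s : Setoid Y) : Setoid (X ⊕ Y) where
  r := Sum.LiftRel r s
  iseqv :=
    { refl := by
        rintro (x | y)
        · exact Sum.LiftRel.inl (r.refl' x)
        · exact Sum.LiftRel.inr (s.refl' y)
      symm := by
        rintro _ _ (h | h)
        · exact Sum.LiftRel.inl (r.symm' h)
        · exact Sum.LiftRel.inr (s.symm' h)
      trans := by
        rintro _ _ _ (h | h) (h' | h')
        · exact Sum.LiftRel.inl (r.trans' h h')
        · exact Sum.LiftRel.inr (s.trans' h h') }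

/-- The tensor product `p ⊗ p'`: each row of `p'` is appended at the right end of the
respective row of `p`. -/
def ColPartition.tensor (p p' : ColPartition) : ColPartition where
  upper := p.upper ++ p'.upper
  lower := p.lower ++ p'.lower
  rel := (sumSetoid p.rel p'.rel).comap (tensorSplit p.upper p'.upper p.lower p'.lower)

/-- The involution `p*`: the two rows exchange their roles. -/
def ColPartition.involution (p : ColPartition) : ColPartition where
  upper := p.lower
  lower := p.upper
  rel := p.rel.comap Sum.swap

/-- The equivalence relation of the composition `p p'`, where `r` is that of `p` (upper row `v`,
lower row `w`) and `r'` is that of `p'` (upper row `u`, lower row `v`): the rows `u`, `v`, `w` are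
put on top of each other, the equivalence relation generated by `r'` on `u`, `v` and by `r` on
`v`, `w` is formed, and the result is restricted to `u` and `w`. -/
def compRel {u v w : List Color} (r : Setoid (Points v w)) (r' : Setoid (Points u v)) :
    Setoid (Points u w) :=
  (Relation.EqvGen.setoid
    (fun x y : Fin u.length ⊕ (Fin v.length ⊕ Fin w.length) =>
      Relation.Map r' (Sum.map id Sum.inl) (Sum.map id Sum.inl) x y ∨
      Relation.Map r Sum.inr Sum.inr x y)).comap (Sum.map id Sum.inr)

/-- A category of partitions: a set of two-colored partitions that is closed under tensor
products, involutions and compositions of composable pairs, and that contains the identity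
partitions of both colors and the two partitions with empty upper row that have a single block
consisting of two lower points of different colors. -/
structure IsCategory (C : Set ColPartition) : Prop where
  tensor_mem : ∀ p p' : ColPartition, p ∈ C → p' ∈ C → p.tensor p' ∈ C
  involution_mem : ∀ p : ColPartition, p ∈ C → p.involution ∈ C
  comp_mem : ∀ (u v w : List Color) (r : Setoid (Points v w)) (r' : Setoid (Points u v)),
    ColPartition.mk v w r ∈ C → ColPartition.mk u v r' ∈ C → ColPartition.mk u w (compRel r r') ∈ C
  id_white_mem : ColPartition.mk [Color.white] [Color.white] ⊤ ∈ C
  id_black_mem : ColPartition.mk [Color.black] [Color.black] ⊤ ∈ C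
  pair_black_white_mem : ColPartition.mk [] [Color.black, Color.white] ⊤ ∈ C
  pair_white_black_mem : ColPartition.mk [] [Color.white, Color.black] ⊤ ∈ C

/-- The category `⟨G⟩` generated by a set `G` of partitions. -/
def generated (G : Set ColPartition) : Set ColPartition :=
  ⋂₀ {C : Set ColPartition | IsCategory C ∧ G ⊆ C}

/-- `⟨G⟩` is indeed the smallest category that contains `G`. -/
theorem isLeast_generated (G : Set ColPartition) :
    IsLeast {C : Set ColPartition | IsCategory C ∧ G ⊆ C} (generated G) := by
  refine ⟨⟨?_, fun p hp C hC => hC.2 hp⟩, fun C hC => Set.sInter_subset_of_mem hC⟩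
  exact
    { tensor_mem := fun p p' hp hp' C hC => hC.1.tensor_mem p p' (hp C hC) (hp' C hC)
      involution_mem := fun p hp C hC => hC.1.involution_mem p (hp C hC)
      comp_mem := fun u v w r r' h h' C hC => hC.1.comp_mem u v w r r' (h C hC) (h' C hC)
      id_white_mem := fun C hC => hC.1.id_white_mem
      id_black_mem := fun C hC => hC.1.id_black_mem
      pair_black_white_mem := fun C hC => hC.1.pair_black_white_mem
      pair_white_black_mem := fun C hC => hC.1.pair_white_black_mem }

/-! ### Orientation, color sum, sectors, crossings, color distance -/

namespace ColPartition

variable (p : ColPartition)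

/-- The points of `p`. -/
abbrev Pt : Type := Points p.upper p.lower

/-- The blocks of `p`. -/
def blocks : Set (Set p.Pt) := p.rel.classes

/-- The position of a point when the points are enumerated along the orientation, that is,
first the lower row from left to right, then the upper row from right to left. -/
def pos : p.Pt → ℕ :=
  Sum.elim (fun i => p.lower.length + (p.upper.length - 1 - i)) (fun j => j)

/-- The points `a`, `b`, `c` are pairwise distinct and occur in the order `(a, b, c)` with respect
to the cyclic order of the points (the orientation). -/
def Between (a b c : p.Pt) : Prop :=
  (p.pos a < p.pos b ∧ p.pos b < p.pos c) ∨
  (p.pos b < p.pos c ∧ p.pos c < p.pos a) ∨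
  (p.pos c < p.pos a ∧ p.pos a < p.pos b)

/-- The open interval `]a, b[` of the cyclic order. -/
def openInterval (a b : p.Pt) : Set p.Pt := {c | p.Between a c b}

/-- The half-open interval `]a, b]` of the cyclic order (empty if `a = b`). -/
def halfOpenInterval (a b : p.Pt) : Set p.Pt := {c | c ≠ a ∧ (p.Between a c b ∨ c = b)}

/-- The closed interval `[a, b]` of the cyclic order. -/
def closedInterval (a b : p.Pt) : Set p.Pt := {c | c = a ∨ p.Between a c b ∨ c = b}

/-- The normalized color of a point: the native color of a lower point, the inverse of the native
color of an upper point. -/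
def normColor : p.Pt → Color :=
  Sum.elim (fun i => (p.upper.get i).inv) (fun j => p.lower.get j)

/-- The color sum `σ_p(S)` of a set `S` of points: the number of points in `S` of normalized color
white minus the number of those of normalized color black. -/
noncomputable def colorSum (S : Set p.Pt) : ℤ :=
  ∑ a : p.Pt, S.indicator (fun b => (p.normColor b).sign) a

/-- `S` is a sector: a proper subset of the points that is an interval of the cyclic order and
whose set of first and last point is a block. -/
def IsSector (S : Set p.Pt) : Prop :=
  S ≠ Set.univ ∧ ∃ a b : p.Pt, S = p.closedInterval a b ∧ {a, b} ∈ p.blocks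

/-- The blocks `B` and `B'` cross. -/
def Cross (B B' : Set p.Pt) : Prop :=
  ∃ a ∈ B, ∃ b ∈ B, ∃ c ∈ B', ∃ d ∈ B', p.Between a c b ∧ p.Between b d a

/-- The signed color distance `δ_p(a, b)` from the point `a` to the point `b`. -/
noncomputable def signedDist (a b : p.Pt) : ℤ :=
  if p.normColor a = p.normColor b then p.colorSum (p.halfOpenInterval a b)
  else p.colorSum (p.openInterval a b)

/-- The absolute color distance `d_p(a, b) = |δ_p(a, b)|`. -/
noncomputable def dist (a b : p.Pt) : ℕ := (p.signedDist a b).natAbs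

end ColPartition

/-- The set of all pair partitions all of whose blocks are neutral. -/
def pairNeutral : Set ColPartition :=
  {p | ∀ B ∈ p.blocks, B.ncard = 2 ∧ p.colorSum B = 0}

/-- The set `S₀` of all pair partitions with neutral blocks all of whose sectors are neutral. -/
def SZero : Set ColPartition :=
  {p | p ∈ pairNeutral ∧ ∀ S : Set p.Pt, p.IsSector S → p.colorSum S = 0}

/-- The set `I_D` of all `p ∈ S₀` such that no two blocks of `p` whose color distance lies in `D`
cross. For `p ∈ S₀` the color distance of two points depends only on their blocks, so the distance
of two blocks may be computed from any of their points. -/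
def I (D : AddSubsemigroup ℕ) : Set ColPartition :=
  {p | p ∈ SZero ∧ ∀ B ∈ p.blocks, ∀ B' ∈ p.blocks, ∀ a ∈ B, ∀ a' ∈ B',
    p.dist a a' ∈ D → ¬ p.Cross B B'}

end TwoColored

namespace TwoColored

/-! Each point carries a level that depends only on its row, read as a lattice path: the lower end
of the step that the point represents. In a pair partition with neutral blocks the total color sum
is zero. Then all sectors are neutral exactly when every block joins points of equal level, and the
color distance of two blocks is their level difference (`signedDist_eq`). Hence `I D` is the set
`strandPartitions D` of string diagrams with level-preserving strings in which strings whose level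
difference lies in `D` do not cross (`I_eq_strandPartitions`). Non-crossing is encoded as an even
number of crossings, computed row by row.

This description makes sense for every set `D` of naturals and always gives a category
(`isCategory_strandPartitions`). Levels are intrinsic to rows, so they agree along a glued row, and
a string of a composition stays on one level. Crossing parities add up along the pieces of composed
strings, so parity zero survives composition (`exists_isStrand_compRel`).

Suppose a finite set `G` generates `I D`. The level differences in `G` are below some `N`, so `G`
lies in the category `strandPartitions (D ∪ {k | N ≤ k})`, and so does `I D`. But for `n > N`
outside `D` there is a partition in `I D` with a crossing at distance `n`
(`isStrand_mountainSetoid`, `not_isStrand_mountainSetoid`), a contradiction. The additive closure of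
`D` enters only in the construction of that partition. -/

/-! ### Strings, levels and crossing parity. -/

/-- The level of the `i`-th letter of a word: the smaller one of the two partial color sums before
and after it. -/
def rowLevel (w : List Color) (i : Fin w.length) : ℤ :=
  ((w.take i).map Color.sign).sum + if w.get i = .white then 0 else -1

/-- The level of a point in its row. -/
def level {u l : List Color} : Points u l → ℤ := Sum.elim (rowLevel u) (rowLevel l)

/-- The sign of the normalized color of a point. -/
def normSign {u l : List Color} : Points u l → ℤ :=
  Sum.elim (fun i => -(u.get i).sign) (fun j => (l.get j).sign)

/-- The indicator of `z` being in the same row as `x` and strictly to the left of `x`. -/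
def leftOf {u l : List Color} : Points u l → Points u l → ZMod 2
  | .inl j, .inl i => if j < i then 1 else 0
  | .inr j, .inr i => if j < i then 1 else 0
  | _, _ => 0

/-- The parity of the number of crossings of the strings `{x, y}` and `{c, d}`. -/
def crossParity {u l : List Color} (x y c d : Points u l) : ZMod 2 :=
  leftOf c x + leftOf c y + (leftOf d x + leftOf d y)

/-- The blocks of `r` are the pairs `{x, σ x}`, they are neutral and join points of equal level,
and they do not cross if their level difference is in `D`. -/
structure IsStrand (D : Set ℕ) {u l : List Color} (r : Setoid (Points u l))
    (σ : Points u l → Points u l) : Prop where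
  invol : ∀ x, σ (σ x) = x
  rel_iff : ∀ x y, r x y ↔ y = x ∨ y = σ x
  sign : ∀ x, normSign (σ x) = -normSign x
  level : ∀ x, level (σ x) = level x
  parity : ∀ x c, c ≠ x → c ≠ σ x → (TwoColored.level x - TwoColored.level c).natAbs ∈ D →
    crossParity x (σ x) c (σ c) = 0

/-- The set of all partitions whose blocks are the strings of some `IsStrand` structure. -/
def strandPartitions (D : Set ℕ) : Set ColPartition := {p | ∃ σ, IsStrand D p.rel σ}

theorem Color.sign_ne_zero (c : Color) : c.sign ≠ 0 := by cases c <;> decide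

theorem normSign_ne_zero {u l : List Color} (x : Points u l) : normSign x ≠ 0 := by
  rcases x with i | i <;> simp [normSign, Color.sign_ne_zero]

theorem IsStrand.ne {D : Set ℕ} {u l : List Color} {r : Setoid (Points u l)}
    {σ : Points u l → Points u l} (h : IsStrand D r σ) (x : Points u l) : σ x ≠ x := by
  intro hx
  have := h.sign x
  rw [hx] at this
  have := normSign_ne_zero x
  omega

/-! ### Pairs of involutions and their dihedral orbits. -/

theorem sum_eq_zero_of_invol {X M : Type*} [AddCommGroup M] (s : Finset X) (g : X → X) (f : X → M)
    (hs : ∀ x ∈ s, g x ∈ s) (hg : ∀ x, g (g x) = x) (hf : ∀ x ∈ s, f x + f (g x) = 0)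
    (hne : ∀ x ∈ s, g x = x → f x = 0) : ∑ x ∈ s, f x = 0 :=
  Finset.sum_involution (fun x _ => g x) hf (fun x hx h0 h => h0 (hne x hx h)) hs
    (fun x _ => hg x)

/-- In an orbit of the dihedral group generated by two involutions without common fixed points,
there are either no or exactly two points that are fixed by one of the involutions. -/
theorem existsUnique_fixed_of_fixed {X : Type*} [Finite X] (R : Setoid X) (S T : X → X)
    (hS : ∀ z, S (S z) = z) (hT : ∀ z, T (T z) = z) (hfix : ∀ z, S z = z → T z ≠ z)
    (hRS : ∀ z, R z (S z)) (hRT : ∀ z, R z (T z))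
    (hmin : ∀ P : X → Prop, (∀ z, P z → P (S z)) → (∀ z, P z → P (T z)) →
      ∀ x y, R x y → P x → P y)
    (x : X) (hx : T x = x) : ∃! y, y ≠ x ∧ R x y ∧ (S y = y ∨ T y = y) := by
  let s : Equiv.Perm X := ⟨S, S, hS, hS⟩
  let t : Equiv.Perm X := ⟨T, T, hT, hT⟩
  have hss : s⁻¹ = s := rfl
  have htt : t⁻¹ = t := rfl
  let ρ : Equiv.Perm X := t * s
  have htx : t x = x := hx
  have ht1 : t * t = 1 := by ext z; exact hT z
  have hs1 : s * s = 1 := by ext z; exact hS z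
  -- The orbit of `x` consists of the points `ρ ^ k x`. Since `t` fixes `x` and inverts `ρ`, the
  -- involutions act on exponents as the reflections `k ↦ -k` and `k ↦ -k - 1`.
  have hconj : t * ρ * t⁻¹ = ρ⁻¹ := by
    simp only [ρ, mul_inv_rev, hss, htt, ← mul_assoc, ht1, one_mul]
  have hconjk : ∀ k : ℤ, t * ρ ^ k = ρ ^ (-k) * t := by
    intro k
    rw [← inv_zpow', ← hconj, conj_zpow]
    simp [mul_assoc]
  have hTk : ∀ k : ℤ, T ((ρ ^ k) x) = (ρ ^ (-k)) x := by
    intro k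
    have := congrArg (fun g : Equiv.Perm X => g x) (hconjk k)
    simp only [Equiv.Perm.mul_apply, htx] at this
    exact this
  have hSk : ∀ k : ℤ, S ((ρ ^ k) x) = (ρ ^ (-k - 1)) x := by
    intro k
    have h1 : s = t * ρ := by simp only [ρ, ← mul_assoc, ht1, one_mul]
    have h2 : S ((ρ ^ k) x) = T ((ρ ^ (k + 1)) x) := by
      change s ((ρ ^ k) x) = t ((ρ ^ (k + 1)) x)
      rw [h1, add_comm, zpow_add]; simp
    rw [h2, hTk]; congr 2; ring
  have horb : ∀ y, R x y → ∃ k : ℤ, y = (ρ ^ k) x := fun y hy =>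
    hmin (fun y => ∃ k : ℤ, y = (ρ ^ k) x) (fun z ⟨k, hk⟩ => ⟨_, hk ▸ hSk k⟩)
      (fun z ⟨k, hk⟩ => ⟨_, hk ▸ hTk k⟩) x y hy ⟨0, by simp⟩
  have hRk : ∀ k : ℤ, R x ((ρ ^ k) x) := by
    have hρ : ∀ z, R z (ρ z) := fun z => R.trans' (hRS z) (hRT (S z))
    intro k
    induction k using Int.induction_on with
    | zero => exact R.refl' _
    | succ i ih =>
      rw [add_comm, zpow_add, zpow_one]
      exact R.trans' ih (hρ _)
    | pred i ih =>
      refine R.trans' ih (R.symm' ?_)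
      have := hρ ((ρ ^ (-(i : ℤ) - 1)) x)
      rwa [← Equiv.Perm.mul_apply, ← zpow_one_add, add_sub_cancel] at this
  -- With `n` the period of `x`, exponents matter modulo `n`. The fixed points are the solutions of
  -- `2k ≡ 0` (for `T`) and `2k + 1 ≡ 0` (for `S`).
  obtain ⟨n, hn0, hn⟩ : ∃ n : ℤ, 0 < n ∧ ∀ a b : ℤ, (ρ ^ a) x = (ρ ^ b) x ↔ n ∣ a - b := by
    refine ⟨MulAction.period ρ x, ?_, fun a b => ?_⟩
    · have : Fintype X := Fintype.ofFinite X
      have := isOfFinOrder_of_finite ρ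
      exact_mod_cast MulAction.period_pos_of_orderOf_pos this.orderOf_pos x
    · rw [← MulAction.zpow_smul_eq_iff_period_dvd, sub_eq_neg_add, zpow_add, mul_smul, zpow_neg,
        inv_smul_eq_iff]
      rfl
  have hx0 : (ρ ^ (0 : ℤ)) x = x := by simp
  have hTf : ∀ k : ℤ, T ((ρ ^ k) x) = (ρ ^ k) x ↔ n ∣ 2 * k := by
    intro k
    rw [hTk, hn, ← dvd_neg]; congr! 1; ring
  have hSf : ∀ k : ℤ, S ((ρ ^ k) x) = (ρ ^ k) x ↔ n ∣ 2 * k + 1 := by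
    intro k
    rw [hSk, hn, ← dvd_neg]; congr! 1; ring
  have hxk : ∀ k : ℤ, (ρ ^ k) x = x ↔ n ∣ k := by
    intro k
    have := hn k 0
    rwa [hx0, sub_zero] at this
  -- Period one would make `x` a common fixed point.
  have hn1 : n ≠ 1 := by
    rintro rfl
    have := (hSf 0).2 (one_dvd _)
    rw [hx0] at this
    exact hfix x this hx
  -- The second end of the orbit is `ρ ^ m x`: fixed by `T` if `n = 2m`, by `S` if `n = 2m + 1`.
  rcases Int.even_or_odd' n with ⟨m, hm | hm⟩
  · refine ⟨(ρ ^ m) x, ⟨?_, hRk m, Or.inr ((hTf m).2 (by rw [hm]))⟩, ?_⟩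
    · rw [Ne, hxk]
      intro h
      have := Int.le_of_dvd (by omega) h
      omega
    · rintro y ⟨hyx, hRy, hy⟩
      obtain ⟨k, rfl⟩ := horb y hRy
      rw [hSf, hTf] at hy
      rw [Ne, hxk] at hyx
      rw [hn]
      rcases hy with ⟨q, hq⟩ | ⟨q, hq⟩
      · rw [hm, mul_assoc] at hq; omega
      · rw [hm, mul_assoc] at hq
        have hk : k = m * q := by omega
        rcases Int.even_or_odd' q with ⟨e, he | he⟩
        · exact absurd ⟨e, by rw [hk, hm, he]; ring⟩ hyx
        · exact ⟨e, by rw [hk, hm, he]; ring⟩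
  · refine ⟨(ρ ^ m) x, ⟨?_, hRk m, Or.inl ((hSf m).2 (by rw [hm]))⟩, ?_⟩
    · rw [Ne, hxk]
      intro h
      have := Int.le_of_dvd (by omega) h
      omega
    · rintro y ⟨hyx, hRy, hy⟩
      obtain ⟨k, rfl⟩ := horb y hRy
      rw [hSf, hTf] at hy
      rw [Ne, hxk] at hyx
      rw [hn]
      have hcop : IsCoprime n 2 := ⟨1, -m, by rw [hm]; ring⟩
      rcases hy with hy | hy
      · refine hcop.dvd_of_dvd_mul_left (y := 2) (z := k - m) ?_
        have : 2 * (k - m) = 2 * k + 1 - n := by rw [hm]; ring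
        rw [this]
        exact dvd_sub hy dvd_rfl
      · exact absurd (hcop.dvd_of_dvd_mul_left hy) hyx

/-- The version of `existsUnique_fixed_of_fixed` that is symmetric in the two involutions. -/
theorem existsUnique_fixed {X : Type*} [Finite X] (R : Setoid X) (S T : X → X)
    (hS : ∀ z, S (S z) = z) (hT : ∀ z, T (T z) = z) (hfix : ∀ z, S z = z → T z ≠ z)
    (hRS : ∀ z, R z (S z)) (hRT : ∀ z, R z (T z))
    (hmin : ∀ P : X → Prop, (∀ z, P z → P (S z)) → (∀ z, P z → P (T z)) →
      ∀ x y, R x y → P x → P y)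
    (x : X) (hx : S x = x ∨ T x = x) : ∃! y, y ≠ x ∧ R x y ∧ (S y = y ∨ T y = y) := by
  rcases hx with hx | hx
  · simp only [or_comm (a := S _ = _)]
    exact existsUnique_fixed_of_fixed R T S hT hS (fun z h h' => hfix z h' h) hRT hRS
      (fun P h h' => hmin P h' h) x hx
  · exact existsUnique_fixed_of_fixed R S T hS hT hfix hRS hRT hmin x hx

/-! ### Composition of string diagrams. -/

section Composition

variable {u v w : List Color}

/-- The inclusion of the upper and the middle row into the three rows of a composition. -/
def upperTwo : Points u v → Fin u.length ⊕ Points v w := Sum.map id Sum.inl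

/-- The inclusion of the upper and the lower row into the three rows of a composition. -/
def outerTwo : Points u w → Fin u.length ⊕ Points v w := Sum.map id Sum.inr

/-- The extension to three rows of a map on the upper two rows. -/
def extendUpper (σ : Points u v → Points u v) :
    Fin u.length ⊕ Points v w → Fin u.length ⊕ Points v w
  | .inl a => upperTwo (σ (.inl a))
  | .inr (.inl b) => upperTwo (σ (.inr b))
  | .inr (.inr c) => .inr (.inr c)

/-- The extension to three rows of a map on the lower two rows. -/
def extendLower (σ : Points v w → Points v w) :
    Fin u.length ⊕ Points v w → Fin u.length ⊕ Points v w :=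
  Sum.map id σ

@[simp] theorem extendUpper_upperTwo (σ : Points u v → Points u v) (z : Points u v) :
    extendUpper (w := w) σ (upperTwo z) = upperTwo (σ z) := by
  rcases z with z | z <;> rfl

theorem upperTwo_injective : Function.Injective (upperTwo (u := u) (v := v) (w := w)) :=
  Sum.map_injective.2 ⟨Function.injective_id, Sum.inl_injective⟩

theorem outerTwo_injective : Function.Injective (outerTwo (u := u) (v := v) (w := w)) :=
  Sum.map_injective.2 ⟨Function.injective_id, Sum.inr_injective⟩

theorem upperTwo_or (z : Fin u.length ⊕ Points v w) :
    (∃ z', z = upperTwo z') ∨ ∃ c, z = .inr (.inr c) := by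
  rcases z with z | z | z
  · exact Or.inl ⟨.inl z, rfl⟩
  · exact Or.inl ⟨.inr z, rfl⟩
  · exact Or.inr ⟨z, rfl⟩

/-- The levels of the points in three rows. -/
def level₃ : Fin u.length ⊕ Points v w → ℤ := Sum.elim (rowLevel u) level

theorem level₃_upperTwo (z : Points u v) : level₃ (w := w) (upperTwo z) = level z := by
  rcases z with z | z <;> rfl

theorem level₃_outerTwo (z : Points u w) : level₃ (v := v) (outerTwo z) = level z := by
  rcases z with z | z <;> rfl

/-- The indicator of `z` being in the same row as `x` and strictly to the left of `x`, in three
rows. -/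
def leftOf₃ : Fin u.length ⊕ Points v w → Fin u.length ⊕ Points v w → ZMod 2
  | .inl j, .inl i => if j < i then 1 else 0
  | .inr j, .inr i => leftOf j i
  | _, _ => 0

theorem leftOf₃_upperTwo (z x : Points u v) :
    leftOf₃ (w := w) (upperTwo z) (upperTwo x) = leftOf z x := by
  rcases z with z | z <;> rcases x with x | x <;> rfl

theorem leftOf₃_outerTwo (z x : Points u w) :
    leftOf₃ (v := v) (outerTwo z) (outerTwo x) = leftOf z x := by
  rcases z with z | z <;> rcases x with x | x <;> rfl

variable {D : Set ℕ} {r : Setoid (Points v w)} {r' : Setoid (Points u v)}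
  {σ : Points v w → Points v w} {σ' : Points u v → Points u v}

/-- The equivalence relation on three rows whose restriction to the outer rows is the
composition. -/
def compRel₃ (r : Setoid (Points v w)) (r' : Setoid (Points u v)) :
    Setoid (Fin u.length ⊕ Points v w) :=
  Relation.EqvGen.setoid
    (fun x y : Fin u.length ⊕ (Fin v.length ⊕ Fin w.length) =>
      Relation.Map r' (Sum.map id Sum.inl) (Sum.map id Sum.inl) x y ∨
      Relation.Map r Sum.inr Sum.inr x y)

theorem extendUpper_invol (h' : IsStrand D r' σ') (z : Fin u.length ⊕ Points v w) :
    extendUpper σ' (extendUpper σ' z) = z := by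
  rcases upperTwo_or z with ⟨z, rfl⟩ | ⟨c, rfl⟩
  · simp [h'.invol]
  · rfl

theorem extendLower_invol (h : IsStrand D r σ) (z : Fin u.length ⊕ Points v w) :
    extendLower σ (extendLower σ z) = z := by
  rcases z with z | z <;> simp [extendLower, h.invol]

theorem extendUpper_eq_self (h' : IsStrand D r' σ') {z : Fin u.length ⊕ Points v w} :
    extendUpper σ' z = z ↔ ∃ c, z = .inr (.inr c) := by
  refine ⟨fun hz => ?_, ?_⟩
  · rcases upperTwo_or z with ⟨z, rfl⟩ | h
    · rw [extendUpper_upperTwo] at hz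
      exact absurd (upperTwo_injective hz) (h'.ne z)
    · exact h
  · rintro ⟨c, rfl⟩; rfl

theorem extendLower_eq_self (h : IsStrand D r σ) {z : Fin u.length ⊕ Points v w} :
    extendLower σ z = z ↔ ∃ a, z = .inl a := by
  refine ⟨fun hz => ?_, ?_⟩
  · rcases z with z | z
    · exact ⟨z, rfl⟩
    · exact absurd (Sum.inr_injective hz) (h.ne z)
  · rintro ⟨c, rfl⟩; rfl

theorem compRel₃_extendUpper (h' : IsStrand D r' σ') (z : Fin u.length ⊕ Points v w) :
    compRel₃ r r' z (extendUpper σ' z) := by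
  rcases upperTwo_or z with ⟨z, rfl⟩ | ⟨c, rfl⟩
  · rw [extendUpper_upperTwo]
    exact Relation.EqvGen.rel _ _ (Or.inl ⟨z, σ' z, (h'.rel_iff _ _).2 (Or.inr rfl), rfl, rfl⟩)
  · exact (compRel₃ r r').refl' _

theorem compRel₃_extendLower (h : IsStrand D r σ) (z : Fin u.length ⊕ Points v w) :
    compRel₃ r r' z (extendLower σ z) := by
  rcases z with z | z
  · exact (compRel₃ r r').refl' _
  · exact Relation.EqvGen.rel _ _ (Or.inr ⟨z, σ z, (h.rel_iff _ _).2 (Or.inr rfl), rfl, rfl⟩)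

/-- A property that is preserved by both involutions is preserved by the generated relation. -/
theorem compRel₃_induction (h : IsStrand D r σ) (h' : IsStrand D r' σ')
    (P : Fin u.length ⊕ Points v w → Prop) (hS : ∀ z, P z → P (extendUpper σ' z))
    (hT : ∀ z, P z → P (extendLower σ z)) (x y : Fin u.length ⊕ Points v w)
    (hxy : compRel₃ r r' x y) (hx : P x) : P y := by
  -- An equivalence is proved so that the symmetry case of the induction goes through; invariance
  -- under an involution holds in both directions.
  have key : P x ↔ P y := by
    have hS' : ∀ z, P (extendUpper σ' z) ↔ P z := fun z =>
      ⟨fun hz => extendUpper_invol h' z ▸ hS _ hz, hS z⟩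
    have hT' : ∀ z, P (extendLower σ z) ↔ P z := fun z =>
      ⟨fun hz => extendLower_invol h z ▸ hT _ hz, hT z⟩
    clear hx
    induction hxy with
    | rel x y hxy =>
      rcases hxy with ⟨a, b, hab, rfl, rfl⟩ | ⟨a, b, hab, rfl, rfl⟩
      · rcases (h'.rel_iff _ _).1 hab with rfl | rfl
        · rfl
        · change P (upperTwo a) ↔ P (upperTwo (σ' a))
          rw [← extendUpper_upperTwo, hS']
      · rcases (h.rel_iff _ _).1 hab with rfl | rfl
        · rfl
        · exact (hT' (.inr a)).symm
    | refl => rfl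
    | symm _ _ _ ih => exact ih.symm
    | trans _ _ _ _ _ ih ih' => exact ih.trans ih'
  exact key.1 hx

/-- The glued blocks are the orbits of the two extended involutions. `extendUpper σ'` fixes
precisely the lower row and `extendLower σ` precisely the upper row, so the points fixed by one of
them are the outer points, and an orbit that contains one contains exactly two. -/
theorem existsUnique_compRel (h : IsStrand D r σ) (h' : IsStrand D r' σ') (x : Points u w) :
    ∃! y, y ≠ x ∧ compRel r r' x y := by
  have hout : ∀ z : Fin u.length ⊕ Points v w,
      (extendUpper σ' z = z ∨ extendLower σ z = z) ↔ ∃ y : Points u w, z = outerTwo y := by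
    intro z
    rw [extendUpper_eq_self h', extendLower_eq_self h]
    constructor
    · rintro (⟨c, rfl⟩ | ⟨c, rfl⟩)
      exacts [⟨.inr c, rfl⟩, ⟨.inl c, rfl⟩]
    · rintro ⟨c | c, rfl⟩
      exacts [Or.inr ⟨c, rfl⟩, Or.inl ⟨c, rfl⟩]
  obtain ⟨z, ⟨hzx, hxz, hz⟩, huniq⟩ := existsUnique_fixed (compRel₃ r r') (extendUpper σ')
    (extendLower σ) (extendUpper_invol h') (extendLower_invol h)
    (fun z hz hz' => by
      obtain ⟨c, rfl⟩ := (extendUpper_eq_self h').1 hz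
      obtain ⟨a, ha⟩ := (extendLower_eq_self h).1 hz'
      cases ha)
    (compRel₃_extendUpper h') (compRel₃_extendLower h) (compRel₃_induction h h')
    (outerTwo x) ((hout _).2 ⟨x, rfl⟩)
  obtain ⟨y, rfl⟩ := (hout z).1 hz
  refine ⟨y, ⟨fun hyx => hzx (hyx ▸ rfl), hxz⟩, ?_⟩
  rintro y' ⟨hy', hxy'⟩
  exact outerTwo_injective
    (huniq _ ⟨fun e => hy' (outerTwo_injective e), hxy', (hout _).2 ⟨y', rfl⟩⟩)

/-- Sums over a class of the composition, where the function vanishes on the middle row. -/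
theorem sum_class_eq {τ : Points u w → Points u w} {M : Type*} [AddCommMonoid M]
    (f : Fin u.length ⊕ Points v w → M) (hf : ∀ b, f (.inr (.inl b)) = 0)
    (hτ : ∀ x y, compRel r r' x y ↔ y = x ∨ y = τ x) (hne : ∀ x, τ x ≠ x) (c : Points u w)
    (s : Finset (Fin u.length ⊕ Points v w)) (hs : ∀ z, z ∈ s ↔ compRel₃ r r' (outerTwo c) z) :
    ∑ z ∈ s, f z = f (outerTwo c) + f (outerTwo (τ c)) := by
  classical
  have hne' : outerTwo (v := v) c ≠ outerTwo (τ c) := fun e => hne c (outerTwo_injective e).symm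
  rw [← Finset.sum_pair hne']
  symm
  apply Finset.sum_subset
  · intro z hz
    rw [hs]
    rcases Finset.mem_insert.1 hz with rfl | hz
    · exact (compRel₃ r r').refl' _
    · rw [Finset.mem_singleton.1 hz]
      exact (hτ _ _).2 (Or.inr rfl)
  · intro z hz hz'
    rw [hs] at hz
    have hout : ∀ y : Points u w, z = outerTwo y → f z = 0 := by
      rintro y rfl
      exfalso
      apply hz'
      rcases (hτ c y).1 hz with rfl | rfl <;> simp
    rcases z with z | z | z
    exacts [hout (.inl z) rfl, hf z, hout (.inr z) rfl]

/-- The normalized sign of a point as a point of the upper partition; zero on the lower row. -/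
def signUpper : Fin u.length ⊕ Points v w → ℤ
  | .inl a => -(u.get a).sign
  | .inr (.inl b) => (v.get b).sign
  | .inr (.inr _) => 0

/-- The normalized sign of a point as a point of the lower partition; zero on the upper row. -/
def signLower : Fin u.length ⊕ Points v w → ℤ
  | .inl _ => 0
  | .inr z => normSign z

theorem signUpper_upperTwo (z : Points u v) : signUpper (w := w) (upperTwo z) = normSign z := by
  rcases z with z | z <;> rfl

/-- The number of points of `s` that are to the left of a point is the same modulo two at both ends
of an upper string that does not cross the strings in `s`. -/
theorem sum_leftOf₃_extendUpper (h' : IsStrand D r' σ') (s : Finset (Fin u.length ⊕ Points v w))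
    (hs : ∀ z ∈ s, extendUpper σ' z ∈ s) (x : Fin u.length ⊕ Points v w) (hx : x ∉ s)
    (hD : ∀ z ∈ s, (level₃ x - level₃ z).natAbs ∈ D) :
    ∑ z ∈ s, leftOf₃ z (extendUpper σ' x) = ∑ z ∈ s, leftOf₃ z x := by
  rw [← sub_eq_zero, ← Finset.sum_sub_distrib]
  rcases upperTwo_or x with ⟨x, rfl⟩ | ⟨c, rfl⟩
  · refine sum_eq_zero_of_invol s (extendUpper σ') _ hs (extendUpper_invol h') ?_ ?_
    · intro z hz
      rcases upperTwo_or z with ⟨z, rfl⟩ | ⟨c, rfl⟩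
      · have hzx : z ≠ x := fun e => hx (e ▸ hz)
        have hzx' : z ≠ σ' x := by
          rintro rfl
          have := hs _ hz
          rw [extendUpper_upperTwo, h'.invol] at this
          exact hx this
        have hl := hD _ hz
        rw [level₃_upperTwo, level₃_upperTwo] at hl
        have := h'.parity x z hzx hzx' hl
        -- The terms of `z` and of its partner together make up the crossing parity of the two
        -- strings.
        simp only [extendUpper_upperTwo, leftOf₃_upperTwo, CharTwo.sub_eq_add]
        rw [← this, crossParity]; ring
      · rcases hσ : σ' x with y | y <;> rcases x with x | x <;>
          simp [extendUpper, upperTwo, hσ, leftOf₃, leftOf]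
    · intro z hz hzz
      obtain ⟨c, rfl⟩ := (extendUpper_eq_self h').1 hzz
      rcases hσ : σ' x with y | y <;> rcases x with x | x <;>
          simp [extendUpper, upperTwo, hσ, leftOf₃, leftOf]
  · simp [extendUpper]

theorem sum_leftOf₃_extendLower (h : IsStrand D r σ) (s : Finset (Fin u.length ⊕ Points v w))
    (hs : ∀ z ∈ s, extendLower σ z ∈ s) (x : Fin u.length ⊕ Points v w) (hx : x ∉ s)
    (hD : ∀ z ∈ s, (level₃ x - level₃ z).natAbs ∈ D) :
    ∑ z ∈ s, leftOf₃ z (extendLower σ x) = ∑ z ∈ s, leftOf₃ z x := by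
  rw [← sub_eq_zero, ← Finset.sum_sub_distrib]
  rcases x with x | x
  · simp [extendLower]
  · refine sum_eq_zero_of_invol s (extendLower σ) _ hs (extendLower_invol h) ?_ ?_
    · intro z hz
      rcases z with z | z
      · simp [extendLower, leftOf₃]
      · have hzx : z ≠ x := fun e => hx (e ▸ hz)
        have hzx' : z ≠ σ x := by
          rintro rfl
          have := hs _ hz
          rw [extendLower, Sum.map_inr, h.invol] at this
          exact hx this
        have := h.parity x z hzx hzx' (hD _ hz)
        simp only [extendLower, Sum.map_inr, leftOf₃, CharTwo.sub_eq_add]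
        rw [← this, crossParity]; ring
    · intro z hz hzz
      obtain ⟨c, rfl⟩ := (extendLower_eq_self h).1 hzz
      simp [extendLower, leftOf₃]

/-- Level, sign and parity are transported along the zigzag of pieces that forms a string of the
composition. Levels are constant on it. Sign and parity come from sums over a whole class, to which
the middle row contributes nothing. -/
theorem exists_isStrand_compRel (h : IsStrand D r σ) (h' : IsStrand D r' σ') :
    ∃ τ, IsStrand D (compRel r r') τ := by
  classical
  choose τ hτ huniq using fun x => existsUnique_compRel h h' x
  have hrel : ∀ x y, compRel r r' x y ↔ y = x ∨ y = τ x := by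
    refine fun x y => ⟨fun hxy => ?_, ?_⟩
    · by_cases hy : y = x
      · exact Or.inl hy
      · exact Or.inr (huniq x y ⟨hy, hxy⟩)
    · rintro (rfl | rfl)
      exacts [(compRel r r').refl' _, (hτ x).2]
  have hne : ∀ x, τ x ≠ x := fun x => (hτ x).1
  have hlevel : ∀ x y : Fin u.length ⊕ Points v w, compRel₃ r r' x y → level₃ y = level₃ x := by
    intro x y hxy
    refine compRel₃_induction h h' (fun y => level₃ y = level₃ x) ?_ ?_ x y hxy rfl
    · intro z hz
      rw [← hz]
      rcases upperTwo_or z with ⟨z, rfl⟩ | ⟨c, rfl⟩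
      · rw [extendUpper_upperTwo, level₃_upperTwo, level₃_upperTwo, h'.level]
      · rfl
    · intro z hz
      rw [← hz]
      rcases z with z | z
      exacts [rfl, h.level z]
  refine ⟨τ, ⟨fun x => ?_, hrel, fun x => ?_, fun x => ?_, fun x c hcx hcτ hD => ?_⟩⟩
  · exact (huniq (τ x) x ⟨(hne x).symm, (compRel r r').symm' (hτ x).2⟩).symm
  · set s := Finset.univ.filter fun z => compRel₃ r r' (outerTwo x) z with hs
    have hmem : ∀ z, z ∈ s ↔ compRel₃ r r' (outerTwo x) z := by simp [hs]
    have hS : ∑ z ∈ s, signUpper z = 0 := by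
      refine sum_eq_zero_of_invol s (extendUpper σ') _ (fun z hz => ?_) (extendUpper_invol h')
        (fun z hz => ?_) (fun z hz hzz => ?_)
      · rw [hmem] at hz ⊢
        exact (compRel₃ r r').trans' hz (compRel₃_extendUpper h' z)
      · rcases upperTwo_or z with ⟨z, rfl⟩ | ⟨c, rfl⟩
        · rw [extendUpper_upperTwo, signUpper_upperTwo, signUpper_upperTwo, h'.sign]; ring
        · rfl
      · obtain ⟨c, rfl⟩ := (extendUpper_eq_self h').1 hzz
        rfl
    have hT : ∑ z ∈ s, signLower z = 0 := by
      refine sum_eq_zero_of_invol s (extendLower σ) _ (fun z hz => ?_) (extendLower_invol h)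
        (fun z hz => ?_) (fun z hz hzz => ?_)
      · rw [hmem] at hz ⊢
        exact (compRel₃ r r').trans' hz (compRel₃_extendLower h z)
      · rcases z with z | z
        · rfl
        · simp [signLower, extendLower, h.sign]
      · obtain ⟨c, rfl⟩ := (extendLower_eq_self h).1 hzz
        rfl
    -- A middle point has opposite normalized colors in the two partitions, so only the two outer
    -- ends survive.
    have key := sum_class_eq (fun z => signUpper z + signLower z)
      (fun b => by simp [signUpper, signLower, normSign]) hrel hne x s hmem
    rw [Finset.sum_add_distrib, hS, hT] at key
    have hsign : ∀ y : Points u w,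
        signUpper (v := v) (outerTwo y) + signLower (v := v) (outerTwo y) = normSign y := by
      rintro (y | y) <;> simp [signUpper, signLower, outerTwo, normSign]
    simp only [hsign] at key
    omega
  · rw [← level₃_outerTwo (v := v), ← level₃_outerTwo (v := v)]
    exact hlevel _ _ (hτ x).2
  · set s := Finset.univ.filter fun z => compRel₃ r r' (outerTwo c) z with hs
    have hmem : ∀ z, z ∈ s ↔ compRel₃ r r' (outerTwo c) z := by simp [hs]
    have hxc : ¬ compRel₃ r r' (outerTwo x) (outerTwo c) := fun hxc =>
      ((hrel x c).1 hxc).elim hcx hcτ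
    have hfar : ∀ z, compRel₃ r r' (outerTwo x) z →
        z ∉ s ∧ ∀ y ∈ s, (level₃ z - level₃ y).natAbs ∈ D := by
      refine fun z hz => ⟨fun hzs => ?_, fun y hy => ?_⟩
      · exact hxc ((compRel₃ r r').trans' hz ((compRel₃ r r').symm' ((hmem z).1 hzs)))
      · rw [hlevel _ _ hz, hlevel _ _ ((hmem y).1 hy), level₃_outerTwo, level₃_outerTwo]
        exact hD
    -- The parity of the number of points of the class of `c` to the left of `z` does not change
    -- while `z` runs along the class of `x`; comparing both ends of the string gives crossing
    -- parity zero.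
    have hconst := compRel₃_induction h h' (fun z => compRel₃ r r' (outerTwo x) z ∧
      ∑ y ∈ s, leftOf₃ y z = ∑ y ∈ s, leftOf₃ y (outerTwo x)) (fun z hz =>
        ⟨(compRel₃ r r').trans' hz.1 (compRel₃_extendUpper h' z), by
          rw [← hz.2]
          refine sum_leftOf₃_extendUpper h' s (fun y hy => ?_) z (hfar z hz.1).1 (hfar z hz.1).2
          rw [hmem] at hy ⊢
          exact (compRel₃ r r').trans' hy (compRel₃_extendUpper h' y)⟩)
        (fun z hz => ⟨(compRel₃ r r').trans' hz.1 (compRel₃_extendLower h z), by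
          rw [← hz.2]
          refine sum_leftOf₃_extendLower h s (fun y hy => ?_) z (hfar z hz.1).1 (hfar z hz.1).2
          rw [hmem] at hy ⊢
          exact (compRel₃ r r').trans' hy (compRel₃_extendLower h y)⟩)
        _ _ (hτ x).2 ⟨(compRel₃ r r').refl' _, rfl⟩
    have hsum : ∀ y : Points u w, ∑ z ∈ s, leftOf₃ z (outerTwo y) = leftOf c y + leftOf (τ c) y := by
      intro y
      rw [sum_class_eq (fun z => leftOf₃ z (outerTwo y))
        (fun b => by rcases y with y | y <;> rfl) hrel hne c s hmem, leftOf₃_outerTwo,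
        leftOf₃_outerTwo]
    have h2 := hconst.2
    change ∑ z ∈ s, leftOf₃ z (outerTwo (τ x)) = _ at h2
    rw [hsum, hsum] at h2
    have h0 := CharTwo.add_self_eq_zero (leftOf c x + leftOf (τ c) x)
    rw [← h0, crossParity, add_add_add_comm, h2]

end Composition

/-! ### Tensor products and involution. -/

section Tensor

variable {u u' l l' : List Color}

/-- The inverse of `tensorSplit`. -/
def tensorJoin : Points u l ⊕ Points u' l' → Points (u ++ u') (l ++ l')
  | .inl (.inl i) => .inl (Fin.cast List.length_append.symm (Fin.castAdd _ i))
  | .inl (.inr i) => .inr (Fin.cast List.length_append.symm (Fin.castAdd _ i))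
  | .inr (.inl i) => .inl (Fin.cast List.length_append.symm (Fin.natAdd _ i))
  | .inr (.inr i) => .inr (Fin.cast List.length_append.symm (Fin.natAdd _ i))

theorem tensorSplit_tensorJoin (z : Points u l ⊕ Points u' l') :
    tensorSplit u u' l l' (tensorJoin z) = z := by
  rcases z with (z | z) | (z | z) <;> simp [tensorSplit, tensorJoin]

theorem exists_tensorJoin (z : Points (u ++ u') (l ++ l')) :
    ∃ y : Points u l ⊕ Points u' l', z = tensorJoin y := by
  rcases z with z | z
  · obtain ⟨k, hk⟩ := finSumFinEquiv.surjective (Fin.cast List.length_append z)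
    rcases k with k | k
    · exact ⟨.inl (.inl k), congrArg Sum.inl (by ext; simpa using (congrArg Fin.val hk).symm)⟩
    · exact ⟨.inr (.inl k), congrArg Sum.inl (by ext; simpa using (congrArg Fin.val hk).symm)⟩
  · obtain ⟨k, hk⟩ := finSumFinEquiv.surjective (Fin.cast List.length_append z)
    rcases k with k | k
    · exact ⟨.inl (.inr k), congrArg Sum.inr (by ext; simpa using (congrArg Fin.val hk).symm)⟩
    · exact ⟨.inr (.inr k), congrArg Sum.inr (by ext; simpa using (congrArg Fin.val hk).symm)⟩

theorem tensorJoin_injective :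
    Function.Injective (tensorJoin : Points u l ⊕ Points u' l' → Points (u ++ u') (l ++ l')) :=
  Function.LeftInverse.injective tensorSplit_tensorJoin

/-- The color sum of a word. -/
def wordSum (w : List Color) : ℤ := (w.map Color.sign).sum

theorem rowLevel_castAdd (i : Fin u.length) (h : u.length + u'.length = (u ++ u').length) :
    rowLevel (u ++ u') (Fin.cast h (Fin.castAdd _ i)) = rowLevel u i := by
  simp [rowLevel, List.take_append_of_le_length i.2.le]

theorem rowLevel_natAdd (i : Fin u'.length) (h : u.length + u'.length = (u ++ u').length) :
    rowLevel (u ++ u') (Fin.cast h (Fin.natAdd _ i)) = wordSum u + rowLevel u' i := by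
  simp [rowLevel, List.take_append, wordSum, add_assoc, List.take_of_length_le]

theorem level_tensorJoin_inl (y : Points u l) :
    level (tensorJoin (u' := u') (l' := l') (.inl y)) = level y := by
  rcases y with y | y <;> exact rowLevel_castAdd y _

/-- Both rows of the right factor are shifted by the same amount because the rows of the left factor
have equal color sums; level differences therefore persist. -/
theorem level_tensorJoin_inr (h : wordSum u = wordSum l) (y : Points u' l') :
    level (tensorJoin (u := u) (l := l) (.inr y)) = wordSum u + level y := by
  rcases y with y | y
  · exact rowLevel_natAdd y _
  · rw [h]; exact rowLevel_natAdd y _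

theorem normSign_tensorJoin (y : Points u l ⊕ Points u' l') :
    normSign (tensorJoin y) = Sum.elim normSign normSign y := by
  rcases y with (y | y) | (y | y) <;> simp [normSign, tensorJoin]

theorem leftOf_tensorJoin_inl (z x : Points u l) :
    leftOf (tensorJoin (u' := u') (l' := l') (.inl z)) (tensorJoin (.inl x)) = leftOf z x := by
  rcases z with z | z <;> rcases x with x | x <;> simp [leftOf, tensorJoin, Fin.lt_def, -Fin.val_fin_lt]

theorem leftOf_tensorJoin_inr (z x : Points u' l') :
    leftOf (tensorJoin (u := u) (l := l) (.inr z)) (tensorJoin (.inr x)) = leftOf z x := by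
  rcases z with z | z <;> rcases x with x | x <;> simp [leftOf, tensorJoin, Fin.lt_def, -Fin.val_fin_lt]

theorem leftOf_tensorJoin_inr_inl (z : Points u' l') (x : Points u l) :
    leftOf (tensorJoin (.inr z)) (tensorJoin (.inl x)) = 0 := by
  rcases z with z | z <;> rcases x with x | x <;> simp [leftOf, tensorJoin, Fin.lt_def, -Fin.val_fin_lt] <;> omega

/-- The row of a point as an element of `ℤ/2`. -/
def rowParity {u l : List Color} : Points u l → ZMod 2 := Sum.elim (fun _ => 0) (fun _ => 1)

/-- The value is one exactly when both points are in the same row. In this affine form the sum over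
the four pairs of ends of two strings is visibly even. -/
theorem leftOf_tensorJoin_inl_inr (z : Points u l) (x : Points u' l') :
    leftOf (tensorJoin (.inl z)) (tensorJoin (.inr x)) = 1 + rowParity z + rowParity x := by
  have h2 : (1 : ZMod 2) + 1 = 0 := rfl
  rcases z with z | z <;> rcases x with x | x <;>
    simp [leftOf, tensorJoin, Fin.lt_def, -Fin.val_fin_lt, rowParity, h2] <;> omega

theorem sum_normSign : ∑ x : Points u l, normSign x = wordSum l - wordSum u := by
  have h : ∀ w : List Color, ∑ i : Fin w.length, (w.get i).sign = wordSum w := by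
    intro w
    rw [wordSum, ← List.ofFn_get (w.map _), List.sum_ofFn]
    exact Fintype.sum_equiv (finCongr (by simp)) _ _ (fun i => by simp)
  rw [Fintype.sum_sum_type]
  simp only [normSign, Sum.elim_inl, Sum.elim_inr, Finset.sum_neg_distrib, h]
  ring

variable {D : Set ℕ} {r : Setoid (Points u l)} {r' : Setoid (Points u' l')}
  {σ : Points u l → Points u l} {σ' : Points u' l' → Points u' l'}

theorem IsStrand.sum_normSign (h : IsStrand D r σ) : ∑ x, normSign (u := u) (l := l) x = 0 :=
  sum_eq_zero_of_invol _ σ _ (fun _ _ => Finset.mem_univ _) h.invol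
    (fun x _ => by rw [h.sign]; ring) (fun x _ hx => absurd hx (h.ne x))

theorem IsStrand.wordSum_eq (h : IsStrand D r σ) : wordSum u = wordSum l := by
  have := h.sum_normSign
  rw [TwoColored.sum_normSign] at this
  omega

theorem IsStrand.tensor (h : IsStrand D r σ) (h' : IsStrand D r' σ') :
    IsStrand D ((sumSetoid r r').comap (tensorSplit u u' l l'))
      (fun z => tensorJoin (Sum.map σ σ' (tensorSplit u u' l l' z))) := by
  have h2 : (2 : ZMod 2) = 0 := rfl
  refine ⟨fun x => ?_, fun x y => ?_, fun x => ?_, fun x => ?_, fun x c => ?_⟩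
  · obtain ⟨x, rfl⟩ := exists_tensorJoin x
    rcases x with x | x <;> simp [tensorSplit_tensorJoin, h.invol, h'.invol]
  · obtain ⟨x, rfl⟩ := exists_tensorJoin x
    obtain ⟨y, rfl⟩ := exists_tensorJoin y
    rw [Setoid.comap_rel, tensorSplit_tensorJoin, tensorSplit_tensorJoin,
      tensorJoin_injective.eq_iff, tensorJoin_injective.eq_iff]
    change Sum.LiftRel r r' x y ↔ _
    rcases x with x | x <;> rcases y with y | y <;> simp [h.rel_iff, h'.rel_iff]
  · obtain ⟨x, rfl⟩ := exists_tensorJoin x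
    simp only [tensorSplit_tensorJoin, normSign_tensorJoin]
    rcases x with x | x <;> simp [h.sign, h'.sign]
  · obtain ⟨x, rfl⟩ := exists_tensorJoin x
    rcases x with x | x
    · simp [tensorSplit_tensorJoin, level_tensorJoin_inl, h.level]
    · simp [tensorSplit_tensorJoin, level_tensorJoin_inr h.wordSum_eq, h'.level]
  · obtain ⟨x, rfl⟩ := exists_tensorJoin x
    obtain ⟨c, rfl⟩ := exists_tensorJoin c
    simp only [tensorSplit_tensorJoin, Ne, tensorJoin_injective.eq_iff, crossParity]
    rcases x with x | x <;> rcases c with c | c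
    · simp only [Sum.map_inl, Sum.inl.injEq, level_tensorJoin_inl, leftOf_tensorJoin_inl]
      exact h.parity x c
    · simp only [Sum.map_inl, Sum.map_inr, leftOf_tensorJoin_inr_inl, add_zero, implies_true]
    · simp only [Sum.map_inl, Sum.map_inr, leftOf_tensorJoin_inl_inr]
      intros
      linear_combination (2 + rowParity c + rowParity x + rowParity (σ c) + rowParity (σ' x)) * h2
    · simp only [Sum.map_inr, Sum.inr.injEq, level_tensorJoin_inr h.wordSum_eq,
        leftOf_tensorJoin_inr, add_sub_add_left_eq_sub]
      exact h'.parity x c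

theorem IsStrand.involution (h : IsStrand D r σ) :
    IsStrand D (r.comap (Sum.swap : Points l u → Points u l))
      (fun z => (σ z.swap).swap) := by
  have hlevel : ∀ x : Points l u, TwoColored.level x = TwoColored.level x.swap := by rintro (x | x) <;> rfl
  have hsign : ∀ x : Points l u, normSign x = -normSign x.swap := by
    rintro (x | x) <;> simp [normSign]
  have hleft : ∀ x y : Points l u, leftOf x y = leftOf x.swap y.swap := by
    rintro (x | x) (y | y) <;> rfl
  have hswap : ∀ (x : Points l u) (y : Points u l), x = y.swap ↔ x.swap = y := fun x y =>
    ⟨fun h => by rw [h, Sum.swap_swap], fun h => by rw [← h, Sum.swap_swap]⟩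
  refine ⟨fun x => by simp [h.invol], fun x y => ?_, fun x => by simp [hsign, h.sign],
    fun x => by simp [hlevel, h.level], fun x c hcx hcσ hD => ?_⟩
  · rw [Setoid.comap_rel, h.rel_iff, hswap, (Equiv.sumComm _ _).injective.eq_iff'
      (b := x) (c := x.swap) rfl |>.symm]
    rfl
  · rw [hlevel, hlevel c] at hD
    rw [Ne, hswap] at hcσ
    have := h.parity x.swap c.swap (fun e => hcx (by simpa using congrArg Sum.swap e)) hcσ hD
    simpa only [crossParity, hleft, Sum.swap_swap] using this

end Tensor

/-! ### The category of string diagrams, for an arbitrary set of distances. -/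

theorem isStrand_top {u l : List Color} (D : Set ℕ) (σ : Points u l → Points u l)
    (hσ : ∀ x, σ (σ x) = x) (hall : ∀ x y, y = x ∨ y = σ x)
    (hsign : ∀ x, normSign (σ x) = -normSign x) (hlevel : ∀ x, level (σ x) = level x) :
    IsStrand D ⊤ σ :=
  ⟨hσ, fun x y => iff_of_true trivial (hall x y), hsign, hlevel,
    fun x c h h' => ((hall x c).elim h h').elim⟩

theorem isCategory_strandPartitions (D : Set ℕ) : IsCategory (strandPartitions D) where
  tensor_mem := fun _ _ ⟨_, h⟩ ⟨_, h'⟩ => ⟨_, h.tensor h'⟩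
  involution_mem := fun _ ⟨_, h⟩ => ⟨_, h.involution⟩
  comp_mem := fun _ _ _ _ _ ⟨_, h⟩ ⟨_, h'⟩ => exists_isStrand_compRel h h'
  id_white_mem := ⟨Sum.swap, isStrand_top D _ (by decide) (by decide) (by decide) (by decide)⟩
  id_black_mem := ⟨Sum.swap, isStrand_top D _ (by decide) (by decide) (by decide) (by decide)⟩
  pair_black_white_mem :=
    ⟨Sum.map id Fin.rev, isStrand_top D _ (by decide) (by decide) (by decide) (by decide)⟩
  pair_white_black_mem :=
    ⟨Sum.map id Fin.rev, isStrand_top D _ (by decide) (by decide) (by decide) (by decide)⟩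

/-! ### Color sums of intervals, levels and color distance. -/

namespace ColPartition

variable {p : ColPartition}

theorem pos_inr (j : Fin p.lower.length) : p.pos (.inr j) = j := rfl

theorem pos_inl (i : Fin p.upper.length) :
    p.pos (.inl i) = p.lower.length + (p.upper.length - 1 - i) := rfl

theorem pos_eq_iff {x y : p.Pt} : p.pos x = p.pos y ↔ x = y := by
  refine ⟨fun h => ?_, fun h => h ▸ rfl⟩
  rcases x with x | x <;> rcases y with y | y <;> simp only [pos_inl, pos_inr] at h
  · exact congrArg Sum.inl (Fin.ext (by omega))
  · omega
  · omega
  · exact congrArg Sum.inr (Fin.ext h)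

theorem sign_normColor (x : p.Pt) : (p.normColor x).sign = normSign x := by
  rcases x with x | x
  · change (p.upper.get x).inv.sign = -(p.upper.get x).sign
    cases p.upper.get x <;> rfl
  · rfl

theorem normColor_eq_iff (x y : p.Pt) : p.normColor x = p.normColor y ↔
    (normSign x : ℤ) = normSign y := by
  rw [← sign_normColor, ← sign_normColor]
  cases p.normColor x <;> cases p.normColor y <;> decide

/-- The color sum of the points before `x` in the orientation. -/
def height (x : p.Pt) : ℤ := ∑ z, if p.pos z < p.pos x then normSign z else 0

/-- If `b` precedes `a`, the interval wraps around and the difference of heights is off by the total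
color sum, which is zero. The vanishing sum `h2` accounts for this, so that the identity can be
checked point by point. -/
theorem colorSum_openInterval (h0 : ∑ z : p.Pt, normSign z = 0) (a b : p.Pt) (hab : a ≠ b) :
    p.colorSum (p.openInterval a b) = height b - height a - normSign a := by
  classical
  have h1 : ∑ z : p.Pt, (if z = a then normSign z else 0) = normSign a := by simp
  have h2 : ∑ z : p.Pt, (if p.pos b < p.pos a then normSign z else 0) = 0 := by
    split_ifs <;> simp [h0]
  suffices h : p.colorSum (p.openInterval a b) = height b - height a -
      ∑ z : p.Pt, (if z = a then normSign z else 0) +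
      ∑ z : p.Pt, (if p.pos b < p.pos a then normSign z else 0) by
    rw [h, h1, h2, add_zero]
  rw [height, height, ← Finset.sum_sub_distrib, ← Finset.sum_sub_distrib,
    ← Finset.sum_add_distrib, colorSum]
  refine Finset.sum_congr rfl fun z _ => ?_
  rw [Ne, ← pos_eq_iff] at hab
  simp only [Set.indicator_apply, openInterval, Between, Set.mem_ofPred_eq, sign_normColor,
    ← pos_eq_iff (x := z)]
  split_ifs <;> omega

theorem colorSum_halfOpenInterval (h0 : ∑ z : p.Pt, normSign z = 0) (a b : p.Pt) :
    p.colorSum (p.halfOpenInterval a b) = height b + normSign b - height a - normSign a := by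
  classical
  have h1 : ∀ a : p.Pt, ∑ z : p.Pt, (if z = a then normSign z else 0) = normSign a := by simp
  have h2 : ∑ z : p.Pt, (if p.pos b < p.pos a then normSign z else 0) = 0 := by
    split_ifs <;> simp [h0]
  suffices h : p.colorSum (p.halfOpenInterval a b) =
      height b + ∑ z : p.Pt, (if z = b then normSign z else 0) - height a -
      ∑ z : p.Pt, (if z = a then normSign z else 0) +
      ∑ z : p.Pt, (if p.pos b < p.pos a then normSign z else 0) by
    rw [h, h1, h1, h2, add_zero]
  rw [height, height, ← Finset.sum_add_distrib, ← Finset.sum_sub_distrib,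
    ← Finset.sum_sub_distrib, ← Finset.sum_add_distrib, colorSum]
  refine Finset.sum_congr rfl fun z _ => ?_
  simp only [Set.indicator_apply, halfOpenInterval, Between, Set.mem_ofPred_eq, sign_normColor,
    ← pos_eq_iff (x := z), Ne]
  split_ifs <;> omega

theorem colorSum_closedInterval (h0 : ∑ z : p.Pt, normSign z = 0) (a b : p.Pt) :
    p.colorSum (p.closedInterval a b) = height b + normSign b - height a := by
  classical
  have h1 : ∀ a : p.Pt, ∑ z : p.Pt, (if z = a then normSign z else 0) = normSign a := by simp
  have h2 : ∑ z : p.Pt, (if p.pos b < p.pos a then normSign z else 0) = 0 := by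
    split_ifs <;> simp [h0]
  suffices h : p.colorSum (p.closedInterval a b) =
      height b + ∑ z : p.Pt, (if z = b then normSign z else 0) - height a +
      ∑ z : p.Pt, (if p.pos b < p.pos a then normSign z else 0) by
    rw [h, h1, h2, add_zero]
  rw [height, height, ← Finset.sum_add_distrib, ← Finset.sum_sub_distrib,
    ← Finset.sum_add_distrib, colorSum]
  refine Finset.sum_congr rfl fun z _ => ?_
  simp only [Set.indicator_apply, closedInterval, Between, Set.mem_ofPred_eq, sign_normColor,
    ← pos_eq_iff (x := z)]
  split_ifs <;> omega

theorem colorSum_univ : p.colorSum Set.univ = ∑ z : p.Pt, normSign z := by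
  simp [colorSum, sign_normColor]

theorem colorSum_pair {x y : p.Pt} (hxy : x ≠ y) :
    p.colorSum {x, y} = normSign x + normSign y := by
  classical
  rw [colorSum, ← Finset.sum_pair (f := fun z : p.Pt => (normSign z : ℤ)) hxy]
  refine (Finset.sum_subset_zero_on_sdiff (Finset.subset_univ ({x, y} : Finset p.Pt)) (fun z hz => ?_)
    (fun z hz => ?_)).symm
  · simp only [Finset.mem_sdiff, Finset.mem_univ, true_and, Finset.mem_insert,
      Finset.mem_singleton] at hz
    exact Set.indicator_of_notMem (show z ∉ ({x, y} : Set p.Pt) from hz) _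
  · simp only [Finset.mem_insert, Finset.mem_singleton] at hz
    rw [Set.indicator_of_mem (show z ∈ ({x, y} : Set p.Pt) from hz), sign_normColor]

end ColPartition

theorem sum_ite_lt_sign (w : List Color) (k : ℕ) :
    ∑ i : Fin w.length, (if (i : ℕ) < k then (w.get i).sign else 0) = wordSum (w.take k) := by
  induction w generalizing k with
  | nil => simp [wordSum]
  | cons c w ih =>
    cases k with
    | zero => simp [wordSum]
    | succ k =>
      have h := ih k
      rw [wordSum] at h ⊢
      rw [List.take_succ_cons, List.map_cons, List.sum_cons, ← h]
      refine (Fin.sum_univ_succ _).trans ?_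
      congr 1
      refine Finset.sum_congr rfl fun i _ => ?_
      simp only [Fin.val_succ, Nat.add_lt_add_iff_right]
      rfl

theorem wordSum_take_succ (w : List Color) (i : Fin w.length) :
    wordSum (w.take (i + 1)) = wordSum (w.take i) + (w.get i).sign := by
  rw [List.take_succ_eq_append_getElem i.2]
  simp only [wordSum, List.map_append, List.sum_append, List.map_cons, List.map_nil,
    List.sum_singleton, List.get_eq_getElem]

theorem normSign_eq (u l : List Color) (x : Points u l) : normSign x = 1 ∨ normSign x = -1 := by
  rcases x with x | x
  · change -(u.get x).sign = 1 ∨ -(u.get x).sign = -1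
    cases u.get x <;> decide
  · change (l.get x).sign = 1 ∨ (l.get x).sign = -1
    cases l.get x <;> decide

namespace ColPartition

variable {p : ColPartition}

theorem height_inr (j : Fin p.lower.length) :
    height (p := p) (.inr j) = wordSum (p.lower.take j) := by
  rw [height, Fintype.sum_sum_type, Finset.sum_eq_zero, zero_add, ← sum_ite_lt_sign]
  · rfl
  · intro i _
    rw [pos_inl, pos_inr, if_neg (by omega)]

/-- The upper row is traversed from right to left, so the points not yet passed are the first `i +
1` letters. Their contribution complements the height to the total, which is zero. -/
theorem height_inl (h0 : ∑ z : p.Pt, normSign z = 0) (i : Fin p.upper.length) :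
    height (p := p) (.inl i) = wordSum (p.upper.take (i + 1)) := by
  have h1 := h0
  rw [sum_normSign] at h1
  have h2 : height (p := p) (.inl i) + ∑ k : Fin p.upper.length,
      (if (k : ℕ) < i + 1 then -(p.upper.get k).sign else 0) = ∑ z : p.Pt, normSign z := by
    rw [height, Fintype.sum_sum_type, Fintype.sum_sum_type, add_right_comm,
      ← Finset.sum_add_distrib]
    congr 1 <;> refine Finset.sum_congr rfl fun k _ => ?_
    · simp only [pos_inl, normSign, Sum.elim_inl]
      split_ifs <;> omega
    · rw [pos_inl, pos_inr, if_pos (by omega)]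
  have h3 : ∑ k : Fin p.upper.length, (if (k : ℕ) < i + 1 then -(p.upper.get k).sign else 0) =
      -wordSum (p.upper.take (i + 1)) := by
    rw [← sum_ite_lt_sign, ← Finset.sum_neg_distrib]
    refine Finset.sum_congr rfl fun k _ => ?_
    split_ifs <;> simp
  omega

theorem level_eq_height (h0 : ∑ z : p.Pt, normSign z = 0) (x : p.Pt) :
    level x = height x + if (normSign x : ℤ) = 1 then 0 else -1 := by
  rcases x with x | x
  · rw [height_inl h0, wordSum_take_succ]
    change wordSum _ + _ = _ + if -(p.upper.get x).sign = 1 then _ else _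
    cases p.upper.get x <;> simp [Color.sign]
  · rw [height_inr]
    change wordSum _ + _ = _ + if (p.lower.get x).sign = 1 then _ else _
    cases p.lower.get x <;> simp [Color.sign]

/-- The choice between half-open and open interval in the color distance is just the correction
between height and level in `level_eq_height`. -/
theorem signedDist_eq (h0 : ∑ z : p.Pt, normSign z = 0) (a b : p.Pt) :
    p.signedDist a b = level b - level a := by
  rw [signedDist, level_eq_height h0, level_eq_height h0]
  have ha := normSign_eq _ _ a
  have hb := normSign_eq _ _ b
  by_cases h : p.normColor a = p.normColor b
  · rw [if_pos h, colorSum_halfOpenInterval h0]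
    rw [normColor_eq_iff] at h
    split_ifs <;> omega
  · rw [if_neg h, colorSum_openInterval h0 _ _ (fun e => h (by rw [e]))]
    rw [normColor_eq_iff] at h
    split_ifs <;> omega

/-! ### Crossings in the cyclic order versus crossing parity. -/

/-- `c` lies strictly between `x` and `y` in the linear order of positions. -/
def LinBetween (x y c : p.Pt) : Prop :=
  (p.pos x < p.pos c ∧ p.pos c < p.pos y) ∨ (p.pos y < p.pos c ∧ p.pos c < p.pos x)

-- Counting within rows differs from separation in the linear order by a term that does not involve
-- `c`; it cancels modulo two when both ends of a second string are added.
open Classical in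
theorem leftOf_add_leftOf (x y c : p.Pt) (hx : c ≠ x) (hy : c ≠ y) :
    leftOf c x + leftOf c y =
      (if LinBetween x y c then 1 else 0) + (rowParity x + rowParity y) := by
  have h2 : (1 : ZMod 2) + 1 = 0 := rfl
  rw [Ne, ← pos_eq_iff] at hx hy
  by_cases h : LinBetween x y c
  all_goals
    simp only [h, if_true, if_false]
    simp only [LinBetween] at h
    rcases x with x | x <;> rcases y with y | y <;> rcases c with c | c <;>
      simp only [pos_inl, pos_inr] at hx hy h <;>
      simp only [leftOf, rowParity, Sum.elim_inl, Sum.elim_inr, Fin.lt_def,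
        add_zero, zero_add, h2] <;>
      (try split_ifs) <;> first | decide | (exfalso; omega)

theorem crossParity_eq_zero_iff (x y c d : p.Pt) (hxy : x ≠ y) (hcd : c ≠ d) (hcx : c ≠ x)
    (hcy : c ≠ y) (hdx : d ≠ x) (hdy : d ≠ y) :
    crossParity x y c d = 0 ↔ ¬ p.Cross {x, y} {c, d} := by
  classical
  have h2 : (1 : ZMod 2) + 1 = 0 := rfl
  rw [crossParity, leftOf_add_leftOf _ _ _ hcx hcy, leftOf_add_leftOf _ _ _ hdx hdy,
    add_add_add_comm, CharTwo.add_self_eq_zero, add_zero]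
  have key : p.Cross {x, y} {c, d} ↔ ¬ (LinBetween x y c ↔ LinBetween x y d) := by
    rw [Ne, ← pos_eq_iff] at hxy hcd hcx hcy hdx hdy
    constructor
    · rintro ⟨a, rfl | rfl, b, rfl | rfl, e, rfl | rfl, f, rfl | rfl, h1, h3⟩ <;>
        simp only [Between, LinBetween] at * <;> omega
    · have hx : x ∈ ({x, y} : Set p.Pt) := Or.inl rfl
      have hy : y ∈ ({x, y} : Set p.Pt) := Or.inr rfl
      have hc : c ∈ ({c, d} : Set p.Pt) := Or.inl rfl
      have hd : d ∈ ({c, d} : Set p.Pt) := Or.inr rfl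
      intro h
      by_cases h1 : LinBetween x y c <;> by_cases h3 : LinBetween x y d <;>
        simp only [h1, h3, iff_self, not_true_eq_false, iff_false, false_iff] at h <;>
        simp only [LinBetween] at h1 h3 <;> rcases Nat.lt_or_gt_of_ne hxy with hlt | hlt
      · exact ⟨x, hx, y, hy, c, hc, d, hd, by simp only [Between]; omega,
          by simp only [Between]; omega⟩
      · exact ⟨y, hy, x, hx, c, hc, d, hd, by simp only [Between]; omega,
          by simp only [Between]; omega⟩
      · exact ⟨x, hx, y, hy, d, hd, c, hc, by simp only [Between]; omega,
          by simp only [Between]; omega⟩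
      · exact ⟨y, hy, x, hx, d, hd, c, hc, by simp only [Between]; omega,
          by simp only [Between]; omega⟩
  rw [key, not_not]
  by_cases h1 : LinBetween x y c <;> by_cases h3 : LinBetween x y d <;> simp [h1, h3, h2]

theorem not_cross_self (x y : p.Pt) : ¬ p.Cross {x, y} {x, y} := by
  rintro ⟨a, rfl | rfl, b, rfl | rfl, e, rfl | rfl, f, rfl | rfl, h1, h3⟩ <;>
    simp only [Between] at * <;> omega

end ColPartition

/-! ### Identification of `I D` with the string diagrams. -/

open ColPartition

theorem IsStrand.block_eq {D : Set ℕ} {p : ColPartition} {σ : p.Pt → p.Pt}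
    (h : IsStrand D p.rel σ) {B : Set p.Pt} (hB : B ∈ p.blocks) {x : p.Pt} (hx : x ∈ B) :
    B = {x, σ x} := by
  obtain ⟨y, rfl⟩ := hB
  ext z
  rw [Set.mem_ofPred_eq, Set.mem_insert_iff, Set.mem_singleton_iff, ← h.rel_iff]
  exact ⟨fun hz => p.rel.trans' hx (p.rel.symm' hz), fun hz => p.rel.trans' (p.rel.symm' hz) hx⟩

theorem IsStrand.mem_I {D : AddSubsemigroup ℕ} {p : ColPartition} {σ : p.Pt → p.Pt}
    (h : IsStrand D p.rel σ) : p ∈ I D := by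
  have h0 := h.sum_normSign
  have hne : ∀ {B}, B ∈ p.blocks → ∃ x, B = {x, σ x} := by
    rintro B ⟨y, rfl⟩
    exact ⟨y, h.block_eq ⟨y, rfl⟩ (p.rel.refl' y)⟩
  refine ⟨⟨fun B hB => ?_, ?_⟩, ?_⟩
  · obtain ⟨x, rfl⟩ := hne hB
    refine ⟨Set.ncard_pair (h.ne x).symm, ?_⟩
    rw [colorSum_pair (h.ne x).symm, h.sign]; ring
  · rintro S ⟨-, a, b, rfl, hab⟩
    rw [colorSum_closedInterval h0]
    have hb : b ∈ ({a, σ a} : Set p.Pt) := by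
      rw [← h.block_eq hab (Set.mem_insert a _)]; simp
    have ha : σ a ∈ ({a, b} : Set p.Pt) := by
      rw [h.block_eq hab (Set.mem_insert a _)]; simp
    have hba : b = σ a := by
      rcases ha with ha | ha
      · exact absurd ha (h.ne a)
      · exact ha.symm
    have h1 := level_eq_height h0 a
    have h2 := level_eq_height h0 b
    have h3 := h.level a
    have h4 := h.sign a
    rw [← hba] at h3 h4
    have := normSign_eq _ _ a
    split_ifs at h1 h2 <;> omega
  · intro B hB B' hB' a ha a' ha' hD
    rw [h.block_eq hB ha, h.block_eq hB' ha']
    by_cases h1 : a' = a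
    · rw [h1]; exact not_cross_self _ _
    by_cases h2 : a' = σ a
    · rw [h2, h.invol, Set.pair_comm (σ a)]; exact not_cross_self _ _
    have h3 : σ a' ≠ a := fun e => h2 (by rw [← e, h.invol])
    have h4 : σ a' ≠ σ a := fun e => h1 (by rw [← h.invol a', e, h.invol])
    rw [← crossParity_eq_zero_iff _ _ _ _ (h.ne a).symm (h.ne a').symm h1 h2 h3 h4]
    refine h.parity a a' h1 h2 ?_
    rwa [ColPartition.dist, signedDist_eq h0, ← Int.natAbs_neg, neg_sub] at hD

theorem exists_isStrand_of_mem_I {D : AddSubsemigroup ℕ} {p : ColPartition} (hp : p ∈ I D) :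
    ∃ σ, IsStrand (D : Set ℕ) p.rel σ := by
  obtain ⟨⟨hpair, hsec⟩, hcross⟩ := hp
  have hex : ∀ x : p.Pt, ∃ y, y ≠ x ∧ ∀ z, p.rel x z ↔ z = x ∨ z = y := by
    intro x
    obtain ⟨a, b, hab, hB⟩ := Set.ncard_eq_two.1 (hpair {y | p.rel y x} ⟨x, rfl⟩).1
    have hz : ∀ z, p.rel x z ↔ z = a ∨ z = b := fun z => by
      have : z ∈ {y | p.rel y x} ↔ z ∈ ({a, b} : Set p.Pt) := by rw [hB]
      exact ⟨fun h => this.1 (p.rel.symm' h), fun h => p.rel.symm' (this.2 h)⟩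
    rcases (hz x).1 (p.rel.refl' x) with rfl | rfl
    · exact ⟨b, hab.symm, hz⟩
    · exact ⟨a, hab, fun z => (hz z).trans or_comm⟩
  choose σ hne hrel using hex
  have hinv : ∀ x, σ (σ x) = x := by
    intro x
    have h1 : p.rel (σ x) x := p.rel.symm' ((hrel x _).2 (Or.inr rfl))
    rcases (hrel _ _).1 h1 with h | h
    exacts [absurd h.symm (hne x), h.symm]
  have hblock : ∀ x, {x, σ x} ∈ p.blocks := by
    refine fun x => ⟨x, ?_⟩
    ext z
    rw [Set.mem_insert_iff, Set.mem_singleton_iff, ← hrel]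
    exact ⟨p.rel.symm', p.rel.symm'⟩
  have hsign : ∀ x, (normSign (σ x) : ℤ) = -normSign x := by
    intro x
    have := (hpair _ (hblock x)).2
    rw [colorSum_pair (hne x).symm] at this
    omega
  have h0 : ∑ x : p.Pt, normSign x = 0 :=
    sum_eq_zero_of_invol _ σ _ (fun _ _ => Finset.mem_univ _) hinv
      (fun x _ => by rw [hsign]; ring) (fun x _ hx => absurd hx (hne x))
  refine ⟨σ, hinv, hrel, hsign, fun x => ?_, fun x c h1 h2 hD => ?_⟩
  · have h1 : p.colorSum (p.closedInterval x (σ x)) = 0 := by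
      -- An interval that exhausts all points is not a sector, but its color sum is the total, hence
      -- zero.
      by_cases h : p.closedInterval x (σ x) = Set.univ
      · rw [h, colorSum_univ, h0]
      · exact hsec _ ⟨h, x, σ x, rfl, hblock x⟩
    rw [colorSum_closedInterval h0] at h1
    have h2 := hsign x
    rw [level_eq_height h0, level_eq_height h0]
    have := normSign_eq _ _ x
    split_ifs <;> omega
  · have h3 : σ c ≠ x := fun e => h2 (by rw [← e, hinv])
    have h4 : σ c ≠ σ x := fun e => h1 (by rw [← hinv c, e, hinv])
    rw [crossParity_eq_zero_iff _ _ _ _ (hne x).symm (hne c).symm h1 h2 h3 h4]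
    refine hcross _ (hblock x) _ (hblock c) x (by simp) c (by simp) ?_
    rwa [ColPartition.dist, signedDist_eq h0, ← Int.natAbs_neg, neg_sub]

theorem I_eq_strandPartitions (D : AddSubsemigroup ℕ) : I D = strandPartitions D :=
  Set.ext fun _ => ⟨exists_isStrand_of_mem_I, fun ⟨_, h⟩ => h.mem_I⟩

/-! ### Partitions in `I D` with a crossing at a prescribed distance. -/

/-- The word `∘ⁿ⁺¹•ⁿ⁺¹`. -/
def mountain (n : ℕ) : List Color :=
  List.replicate (n + 1) Color.white ++ List.replicate (n + 1) Color.black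

theorem length_mountain (n : ℕ) : (mountain n).length = 2 * n + 2 := by
  simp [mountain]; omega

/-- The level of a letter of `mountain n`. -/
def mountainLevel (n : ℕ) (i : Fin (mountain n).length) : ℕ := min (i : ℕ) (i.rev : ℕ)

theorem mountainLevel_rev (n : ℕ) (i : Fin (mountain n).length) :
    mountainLevel n i.rev = mountainLevel n i := by
  rw [mountainLevel, mountainLevel, Fin.rev_rev, min_comm]

theorem mountain_get (n : ℕ) (i : Fin (mountain n).length) :
    (mountain n).get i = if (i : ℕ) < n + 1 then .white else .black := by
  rw [List.get_eq_getElem]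
  simp only [mountain, List.getElem_append, List.getElem_replicate, List.length_replicate,
    dite_eq_ite]

theorem rowLevel_mountain (n : ℕ) (i : Fin (mountain n).length) :
    rowLevel (mountain n) i = mountainLevel n i := by
  have hl := length_mountain n
  have hi := i.2
  rw [rowLevel, mountain_get, mountainLevel, Fin.val_rev]
  rcases Nat.lt_or_ge i (n + 1) with h | h
  · have : ((mountain n).take i) = List.replicate i Color.white := by
      simp [mountain, List.take_append, List.take_replicate, h.le, Nat.sub_eq_zero_of_le h.le]
    rw [this, if_pos h]
    simp [Color.sign]
    omega
  · have : ((mountain n).take i) =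
        List.replicate (n + 1) Color.white ++ List.replicate (i - (n + 1)) Color.black := by
      simp only [mountain, List.take_append, List.take_replicate, List.length_replicate]
      rw [min_eq_right h, min_eq_left (by omega)]
    rw [this, if_neg (Nat.not_lt.2 h)]
    simp [Color.sign]
    omega

theorem mountain_get_rev_sign (n : ℕ) (i : Fin (mountain n).length) :
    ((mountain n).get i.rev).sign = -((mountain n).get i).sign := by
  have hl := length_mountain n
  rw [mountain_get, mountain_get, Fin.val_rev]
  split_ifs <;> first | rfl | (exfalso; omega)

open Classical in
/-- The points of level in `S` are joined with the opposite point of the same row, the others with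
the opposite point of the other row. -/
noncomputable def mountainPartner (S : Set ℕ) (n : ℕ) :
    Points (mountain n) (mountain n) → Points (mountain n) (mountain n)
  | .inl i => if mountainLevel n i ∈ S then .inl i.rev else .inr i
  | .inr i => if mountainLevel n i ∈ S then .inr i.rev else .inl i

theorem mountainPartner_invol (S : Set ℕ) (n : ℕ) (x : Points (mountain n) (mountain n)) :
    mountainPartner S n (mountainPartner S n x) = x := by
  rcases x with i | i <;> by_cases h : mountainLevel n i ∈ S <;>
    simp [mountainPartner, h, mountainLevel_rev]

/-- The equivalence relation whose classes are the pairs of `mountainPartner S n`. -/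
def mountainSetoid (S : Set ℕ) (n : ℕ) : Setoid (Points (mountain n) (mountain n)) where
  r := fun x y => y = x ∨ y = mountainPartner S n x
  iseqv :=
    { refl := fun _ => Or.inl rfl
      symm := by
        rintro x y (rfl | rfl)
        exacts [Or.inl rfl, Or.inr (mountainPartner_invol S n x).symm]
      trans := by
        rintro x y z (rfl | rfl) (rfl | rfl)
        exacts [Or.inl rfl, Or.inr rfl, Or.inr rfl, Or.inl (mountainPartner_invol S n x)] }

theorem level_mountain (n : ℕ) (x : Points (mountain n) (mountain n)) :
    level x = (Sum.elim (mountainLevel n) (mountainLevel n) x : ℕ) := by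
  rcases x with i | i <;> exact rowLevel_mountain n i

/-- Arcs within a row are nested and through strings are parallel. An arc meets a through string of
the same diagram only if the through string has the larger level and so starts or ends beneath the
arc; `hS` excludes this. -/
theorem crossParity_mountainPartner (S : Set ℕ) (n : ℕ) (x c : Points (mountain n) (mountain n))
    (hcx : c ≠ x) (hcσ : c ≠ mountainPartner S n x)
    (hS : ∀ a b : Points (mountain n) (mountain n), a = x ∧ b = c ∨ a = c ∧ b = x →
      Sum.elim (mountainLevel n) (mountainLevel n) a ∈ S →
      Sum.elim (mountainLevel n) (mountainLevel n) b ∉ S →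
      Sum.elim (mountainLevel n) (mountainLevel n) b <
        Sum.elim (mountainLevel n) (mountainLevel n) a) :
    crossParity x (mountainPartner S n x) c (mountainPartner S n c) = 0 := by
  have h1 := hS x c (Or.inl ⟨rfl, rfl⟩)
  have h2 := hS c x (Or.inr ⟨rfl, rfl⟩)
  clear hS
  rcases x with i | i <;> rcases c with j | j <;>
    simp only [Sum.elim_inl, Sum.elim_inr] at h1 h2 <;>
    by_cases hi : mountainLevel n i ∈ S <;> by_cases hj : mountainLevel n j ∈ S <;>
    simp only [hi, hj, not_true_eq_false, not_false_eq_true, forall_const, IsEmpty.forall_iff]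
      at h1 h2 <;>
    simp only [mountainPartner, hi, hj, if_true, if_false, crossParity, leftOf, Ne,
      Sum.inl.injEq, Sum.inr.injEq, reduceCtorEq, not_false_eq_true] at hcx hcσ ⊢ <;>
    simp only [mountainLevel, Fin.val_rev, Fin.lt_def, Fin.ext_iff] at * <;>
    (try split_ifs) <;> first | decide | (exfalso; omega)

/-- Let an arc of level `a ∈ {0} ∪ D` cross a through string of level `b > a`. If `b - a` were in
`D`, then `b = a + (b - a)` would be in `D` by additive closure, and the points of level `b` would
be joined by arcs instead. -/
theorem isStrand_mountainSetoid (D : AddSubsemigroup ℕ) (n : ℕ) :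
    IsStrand (D : Set ℕ) (mountainSetoid ({0} ∪ D) n) (mountainPartner ({0} ∪ D) n) := by
  refine ⟨mountainPartner_invol _ n, fun x y => Iff.rfl, fun x => ?_, fun x => ?_,
    fun x c hcx hcσ hD => crossParity_mountainPartner _ n x c hcx hcσ fun a b hab ha hb => ?_⟩
  · have hr := mountain_get_rev_sign n
    rcases x with i | i <;> by_cases h : mountainLevel n i ∈ ({0} ∪ D : Set ℕ) <;>
      simp only [mountainPartner, h, if_true, if_false, normSign, Sum.elim_inl, Sum.elim_inr, hr,
        neg_neg]
  · rw [level_mountain, level_mountain]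
    rcases x with i | i <;> by_cases h : mountainLevel n i ∈ ({0} ∪ D : Set ℕ) <;>
      simp only [mountainPartner, h, if_true, if_false, Sum.elim_inl, Sum.elim_inr,
        mountainLevel_rev]
  · by_contra hlt
    rw [level_mountain, level_mountain] at hD
    have hmem : Sum.elim (mountainLevel n) (mountainLevel n) b -
        Sum.elim (mountainLevel n) (mountainLevel n) a ∈ D := by
      have h1 : Sum.elim (mountainLevel n) (mountainLevel n) b -
          Sum.elim (mountainLevel n) (mountainLevel n) a =
          ((Sum.elim (mountainLevel n) (mountainLevel n) x : ℕ) -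
            (Sum.elim (mountainLevel n) (mountainLevel n) c : ℕ) : ℤ).natAbs := by
        rcases hab with ⟨rfl, rfl⟩ | ⟨rfl, rfl⟩ <;> omega
      rw [h1]
      exact hD
    refine hb (Or.inr ?_)
    rcases ha with ha | ha
    · rw [Set.mem_singleton_iff] at ha
      rwa [ha, Nat.sub_zero] at hmem
    · have := D.add_mem ha hmem
      rwa [Nat.add_sub_cancel' (by omega)] at this

/-- The outermost arc, of level `0`, crosses the through string at position `n`, the last white
letter, which has level `n`. -/
theorem not_isStrand_mountainSetoid {D D' : Set ℕ} {n : ℕ} (hn : 1 ≤ n) (hnD : n ∉ D)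
    (hnD' : n ∈ D') (σ : Points (mountain n) (mountain n) → Points (mountain n) (mountain n)) :
    ¬ IsStrand D' (mountainSetoid ({0} ∪ D) n) σ := by
  intro h
  have hl := length_mountain n
  have hσ : ∀ x, σ x = mountainPartner ({0} ∪ D) n x := by
    intro x
    have h1 : mountainSetoid ({0} ∪ D) n x (σ x) := (h.rel_iff _ _).2 (Or.inr rfl)
    exact h1.resolve_left (h.ne x)
  let i : Fin (mountain n).length := ⟨0, by omega⟩
  let j : Fin (mountain n).length := ⟨n, by omega⟩
  have hi : mountainLevel n i = 0 := by simp [mountainLevel, i]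
  have hj : mountainLevel n j = n := by
    simp only [mountainLevel, j, Fin.val_rev]; omega
  have hiσ : σ (.inl i) = .inl i.rev := by
    rw [hσ]; simp [mountainPartner, hi]
  have hjσ : σ (.inl j) = .inr j := by
    rw [hσ]
    have : n ∉ ({0} ∪ D : Set ℕ) := by
      rintro (h | h)
      · rw [Set.mem_singleton_iff] at h; omega
      · exact hnD h
    simp only [mountainPartner, hj, this, if_false]
  have hp := h.parity (.inl i) (.inl j) ?_ ?_ ?_
  · rw [hiσ, hjσ] at hp
    simp only [crossParity, leftOf, Fin.lt_def, Fin.val_rev, i, j] at hp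
    rw [if_neg (by omega), if_pos (by omega)] at hp
    exact absurd hp (by decide)
  · simp [i, j]; omega
  · rw [hiσ]
    simp only [Ne, Sum.inl.injEq, Fin.ext_iff, Fin.val_rev, i, j]; omega
  · rw [level_mountain, level_mountain]
    simpa [hi, hj] using hnD'

/-! ### No finite set of generators. -/

/-- The level differences that occur in the members of a finite set of partitions are bounded. -/
theorem exists_level_bound {G : Set ColPartition} (hG : G.Finite) :
    ∃ N : ℕ, ∀ p ∈ G, ∀ x c : p.Pt, (level x - level c).natAbs < N := by
  have hfin : (⋃ p ∈ G, Set.range fun xc : p.Pt × p.Pt =>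
      (level xc.1 - level xc.2).natAbs).Finite :=
    hG.biUnion fun p _ => Set.finite_range _
  obtain ⟨N, hN⟩ := hfin.bddAbove
  exact ⟨N + 1, fun p hp x c => Nat.lt_succ_of_le (hN (Set.mem_biUnion hp ⟨(x, c), rfl⟩))⟩

theorem infinite_of_generated_eq (D : AddSubsemigroup ℕ) (hD : {n : ℕ | 1 ≤ n ∧ n ∉ D}.Infinite)
    (G : Set ColPartition) (hG : generated G = I D) : G.Infinite := by
  intro hfin
  obtain ⟨N, hN⟩ := exists_level_bound hfin
  obtain ⟨n, ⟨hn1, hnD⟩, hNn⟩ := hD.exists_gt N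
  -- Forbidding crossings at distances from `N` on costs nothing for `G`, where such distances do
  -- not occur.
  have hsub : G ⊆ strandPartitions (D ∪ {k | N ≤ k}) := by
    intro p hp
    have hpI : p ∈ I D := hG ▸ (isLeast_generated G).1.2 hp
    obtain ⟨σ, h⟩ := exists_isStrand_of_mem_I hpI
    refine ⟨σ, h.invol, h.rel_iff, h.sign, h.level, fun x c hcx hcσ hl => ?_⟩
    rcases hl with hl | hl
    · exact h.parity x c hcx hcσ hl
    · exact absurd (hN p hp x c) (not_lt.2 hl)
  have hle := (isLeast_generated G).2 ⟨isCategory_strandPartitions _, hsub⟩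
  have hmem : ColPartition.mk _ _ (mountainSetoid ({0} ∪ D) n) ∈ I D :=
    (isStrand_mountainSetoid D n).mem_I
  rw [← hG] at hmem
  obtain ⟨σ, h⟩ := hle hmem
  exact not_isStrand_mountainSetoid hn1 hnD (Or.inr hNn.le) σ h

end TwoColored

theorem mainTheorem5 :
    (∀ D : AddSubsemigroup ℕ, {n : ℕ | 1 ≤ n ∧ n ∉ D}.Infinite →
      TwoColored.IsCategory (TwoColored.I D) ∧
      ∀ G : Set TwoColored.ColPartition,
        TwoColored.generated G = TwoColored.I D → G.Infinite) ∧
    (∃ C : Set TwoColored.ColPartition, TwoColored.IsCategory C ∧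
      ∀ G : Set TwoColored.ColPartition, TwoColored.generated G = C → G.Infinite) := by
  have main : ∀ D : AddSubsemigroup ℕ, {n : ℕ | 1 ≤ n ∧ n ∉ D}.Infinite →
      TwoColored.IsCategory (TwoColored.I D) ∧
      ∀ G : Set TwoColored.ColPartition,
        TwoColored.generated G = TwoColored.I D → G.Infinite := fun D hD =>
    ⟨TwoColored.I_eq_strandPartitions D ▸ TwoColored.isCategory_strandPartitions D,
      TwoColored.infinite_of_generated_eq D hD⟩
  -- The empty semigroup is a valid choice; it forbids no crossings at all.
  refine ⟨main, TwoColored.I ⊥, main ⊥ ?_⟩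
  have := Set.Ici_infinite (1 : ℕ)
  simpa [AddSubsemigroup.notMem_bot, Set.Ici] using this
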